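/- Let $\Lambda$ be Connes' cyclic category: its objects are $\langle n\rangle$, $n\ge 0$, and $\operatorname{Hom}_\Lambda(\langle n\rangle,\langle m\rangle)$ is the set of monotone maps $f\colon\mathbb Z\to\mathbb Z$ with $f(k+n+1)=f(k)+m+1$ for all $k$, modulo the relation $f\sim f+c(m+1)$ for $c\in\mathbb Z$. Let $j\colon\Delta\to\Lambda$, $[n]\mapsto\langle n\rangle$, be the inclusion extending a monotone map $\varphi\colon\{0,\dots,n\}\to\{0,\dots,m\}$ equivariantly to $\mathbb Z$, let $\Lambda[n]=\operatorname{Hom}_\Lambda(-,\langle n\rangle)$ be the representable cyclic set, and let $j^*\Lambda[n]$ be its underlying simplicial set. Every morphism $\langle k\rangle\to\langle n\rangle$ of $\Lambda$ can be written uniquely as $j(\varphi)\circ g$ with $\varphi\in\operatorname{Hom}_\Delta([k],[n])$ and $g\in\operatorname{Aut}_\Lambda(\langle k\rangle)$ (the canonical factorization); thus $k$-simplices of $j^*\Lambda[n]$ are pairs $(\varphi,g)$. Let $\Lambda_*$ be the simplicial set with $\Lambda_k=\operatorname{Aut}_\Lambda(\langle k\rangle)$, in which $\theta\colon[l]\to[k]$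 sends $g$ to the automorphism part of the canonical factorization of $g\circ j(\theta)$. For a simplicial set $X$, write $[\sigma,x]\in|X|$ for the point given by $\sigma\in X_k$ and a point $x$ of the topological $k$-simplex, on which $\operatorname{Aut}_\Lambda(\langle k\rangle)$ acts by permuting the vertices. Then: (1) There are a homeomorphism $e\colon|\Lambda_*|\to S^1$ and homeomorphisms $$\Phi_n\colon |j^*\Lambda[n]|\longrightarrow S^1\times|\Delta[n]|,\qquad \Phi_n[(\varphi,g),x]=\bigl(e[g,x],\,[\varphi,g\cdot x]\bigr),$$ natural in $[n]\in\Delta$; that is, the functors $|j^*\Lambda[-]|$ and $S^1\times|\Delta[-]|$ from $\Delta$ to topological spaces are naturally isomorphic through maps of this form. (2) For every morphism $f$ of $\Lambda$, the induced map $j^*\Lambda[f]$ is a weak equivalence of simplicial sets, i.e. its geometric realization induces a bijection on path components and isomorphisms on all homotopy groups at all base points. -/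

import Mathlib

open CategoryTheory Opposite

noncomputable section

namespace CyclicCat

/-- Monotone maps `f : ℤ → ℤ` with `f (k + (n + 1)) = f k + (m + 1)`, i.e. monotone maps that are
`ℤ`-equivariant when `1 ∈ ℤ` acts on the source by `+ (n + 1)` and on the target by `+ (m + 1)`. -/
@[ext]
structure ParaHom (n m : ℕ) where
  toFun : ℤ → ℤ
  monotone' : Monotone toFun
  map_add' : ∀ k : ℤ, toFun (k + ((n : ℤ) + 1)) = toFun k + ((m : ℤ) + 1)

namespace ParaHom

variable {n m l : ℕ}

instance : CoeFun (ParaHom n m) (fun _ => ℤ → ℤ) := ⟨ParaHom.toFun⟩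

/-- Equivariance under the whole group `ℤ`. -/
lemma map_add_mul (f : ParaHom n m) (k c : ℤ) :
    f (k + c * ((n : ℤ) + 1)) = f k + c * ((m : ℤ) + 1) := by
  induction c using Int.induction_on with
  | zero => simp
  | succ i ih =>
    have h := f.map_add' (k + i * ((n : ℤ) + 1))
    rw [ih] at h
    rw [show k + ((i : ℤ) + 1) * ((n : ℤ) + 1) = k + i * ((n : ℤ) + 1) + ((n : ℤ) + 1) by ring, h]
    ring
  | pred i ih =>
    have h := f.map_add' (k + (-(i : ℤ) - 1) * ((n : ℤ) + 1))
    rw [show k + (-(i : ℤ) - 1) * ((n : ℤ) + 1) + ((n : ℤ) + 1) = k + -(i : ℤ) * ((n : ℤ) + 1) by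
      ring, ih] at h
    linarith

/-- The identity. -/
def id (n : ℕ) : ParaHom n n := ⟨fun k => k, fun _ _ h => h, fun _ => rfl⟩

/-- Composition, in diagrammatic order. -/
def comp (f : ParaHom n m) (g : ParaHom m l) : ParaHom n l where
  toFun k := g (f k)
  monotone' _ _ h := g.monotone' (f.monotone' h)
  map_add' k := by rw [f.map_add', g.map_add']

/-- Translation by `a`. -/
def shift (n : ℕ) (a : ℤ) : ParaHom n n where
  toFun k := k + a
  monotone' _ _ h := by simpa using h
  map_add' k := by ring

/-- The orbit relation of the `ℤ`-action `(c • f) k = f k + c (m + 1) = f (k + c (n + 1))`. -/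
instance orbit (n m : ℕ) : Setoid (ParaHom n m) where
  r f g := ∃ c : ℤ, ∀ k, g k = f k + c * ((m : ℤ) + 1)
  iseqv :=
    { refl := fun f => ⟨0, fun k => by ring⟩
      symm := by
        rintro f g ⟨c, h⟩
        exact ⟨-c, fun k => by rw [h k]; ring⟩
      trans := by
        rintro f g h ⟨c, hc⟩ ⟨d, hd⟩
        exact ⟨c + d, fun k => by rw [hd k, hc k]; ring⟩ }

end ParaHom

/-- The residue of an integer modulo `n + 1`, as one of `0, …, n`. -/
def residue (n : ℕ) (k : ℤ) : Fin (n + 1) :=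
  ⟨(k % ((n : ℤ) + 1)).toNat, by
    have h1 := Int.emod_lt_of_pos k (show (0 : ℤ) < (n : ℤ) + 1 by positivity)
    have h0 := Int.emod_nonneg k (show ((n : ℤ) + 1) ≠ 0 by positivity)
    omega⟩

lemma residue_val (n : ℕ) (k : ℤ) : ((residue n k : ℕ) : ℤ) = k % ((n : ℤ) + 1) :=
  Int.toNat_of_nonneg (Int.emod_nonneg k (by positivity))

lemma residue_coe (n : ℕ) (i : Fin (n + 1)) : residue n (i : ℕ) = i := by
  have h := residue_val n (i : ℕ)
  rw [Int.emod_eq_of_lt (by positivity) (by have := i.2; omega)] at h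
  exact Fin.ext (by exact_mod_cast h)

lemma residue_add_mul (n : ℕ) (k c : ℤ) : residue n (k + c * ((n : ℤ) + 1)) = residue n k := by
  simp [residue]

end CyclicCat

/-- Objects `⟨n⟩`, `n ≥ 0`, of Connes' cyclic category `Λ`. -/
structure CyclicCat : Type where
  /-- `⟨n⟩` is the circle with `n + 1` marked points. -/
  len : ℕ

namespace CyclicCat

/-- Connes' cyclic category `Λ`: a morphism `⟨n⟩ ⟶ ⟨m⟩` is a `ℤ`-orbit of equivariant monotone maps
of universal covers. -/
instance : SmallCategory CyclicCat where
  Hom a b := Quotient (ParaHom.orbit a.len b.len)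
  id a := Quotient.mk _ (ParaHom.id a.len)
  comp {a b c} f g := Quotient.map₂ ParaHom.comp (by
    rintro f f' ⟨x, hx⟩ g g' ⟨y, hy⟩
    refine ⟨x + y, fun k => ?_⟩
    change g' (f' k) = g (f k) + _
    rw [hy, hx, g.map_add_mul]
    ring) f g
  id_comp := by rintro a b ⟨f⟩; rfl
  comp_id := by rintro a b ⟨f⟩; rfl
  assoc := by rintro a b c d ⟨f⟩ ⟨g⟩ ⟨h⟩; rfl

/-- The morphism of `Λ` represented by an equivariant monotone map. -/
def mkHom {a b : CyclicCat} (f : ParaHom a.len b.len) : a ⟶ b := Quotient.mk _ f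

lemma mkHom_comp {a b c : CyclicCat} (f : ParaHom a.len b.len) (g : ParaHom b.len c.len) :
    mkHom f ≫ mkHom g = mkHom (f.comp g) := rfl

lemma mkHom_surjective {a b : CyclicCat} (f : a ⟶ b) : ∃ F, mkHom F = f := Quotient.exists_rep f

lemma mkHom_eq_iff {a b : CyclicCat} (f g : ParaHom a.len b.len) :
    mkHom f = mkHom g ↔ ∃ c : ℤ, ∀ k, g k = f k + c * ((b.len : ℤ) + 1) := Quotient.eq

/-- The map on marked points `{0, …, n} → {0, …, m}` underlying a morphism `⟨n⟩ ⟶ ⟨m⟩`. -/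
def underlying {a b : CyclicCat} (f : a ⟶ b) : Fin (a.len + 1) → Fin (b.len + 1) :=
  Quotient.lift (s := ParaHom.orbit a.len b.len)
    (fun F (i : Fin (a.len + 1)) => residue b.len (F ((i : ℕ) : ℤ))) (by
    rintro F G ⟨c, hc⟩
    funext i
    rw [hc, residue_add_mul]) f

/-- The `ℤ`-equivariant extension of a monotone map `{0, …, n} → {0, …, m}`:
`r + q (n + 1) ↦ φ r + q (m + 1)` for `0 ≤ r ≤ n`. -/
def extend {n m : ℕ} (φ : Fin (n + 1) →o Fin (m + 1)) : ParaHom n m where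
  toFun k := ((φ (residue n k) : ℕ) : ℤ) + k / ((n : ℤ) + 1) * ((m : ℤ) + 1)
  monotone' := by
    intro k k' h
    have hn : (0 : ℤ) < (n : ℤ) + 1 := by positivity
    have hq : k / ((n : ℤ) + 1) ≤ k' / ((n : ℤ) + 1) := Int.ediv_le_ediv hn h
    dsimp only
    rcases hq.eq_or_lt with hq | hq
    · have hr : residue n k ≤ residue n k' := by
        have h1 := residue_val n k
        have h2 := residue_val n k'
        have h3 := Int.emod_add_mul_ediv k ((n : ℤ) + 1)
        have h4 := Int.emod_add_mul_ediv k' ((n : ℤ) + 1)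
        rw [hq] at h3
        rw [Fin.le_def]
        omega
      have := φ.monotone hr
      rw [Fin.le_def] at this
      rw [hq]
      gcongr
    · have h1 := (φ (residue n k)).2
      have h2 : (k / ((n : ℤ) + 1) + 1) * ((m : ℤ) + 1) ≤ k' / ((n : ℤ) + 1) * ((m : ℤ) + 1) := by
        gcongr
        omega
      have h3 : (0 : ℤ) ≤ ((φ (residue n k') : ℕ) : ℤ) := by positivity
      have h4 : ((φ (residue n k) : ℕ) : ℤ) < (m : ℤ) + 1 := by exact_mod_cast h1
      linarith
  map_add' k := by
    have h := residue_add_mul n k 1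
    rw [one_mul] at h
    rw [h, Int.add_ediv_of_dvd_right (dvd_refl _), Int.ediv_self (by positivity)]
    ring

lemma extend_apply {n m : ℕ} (φ : Fin (n + 1) →o Fin (m + 1)) (k : ℤ) :
    extend φ k = ((φ (residue n k) : ℕ) : ℤ) + k / ((n : ℤ) + 1) * ((m : ℤ) + 1) := rfl

lemma extend_coe {n m : ℕ} (φ : Fin (n + 1) →o Fin (m + 1)) (i : Fin (n + 1)) :
    extend φ ((i : ℕ) : ℤ) = ((φ i : ℕ) : ℤ) := by
  rw [extend_apply, residue_coe, Int.ediv_eq_zero_of_lt (by positivity) (by have := i.2; omega)]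
  simp

/-- An equivariant map is determined by its values on `0, …, n`. -/
lemma ParaHom.ext_fin {n m : ℕ} {f g : ParaHom n m}
    (h : ∀ i : Fin (n + 1), f ((i : ℕ) : ℤ) = g ((i : ℕ) : ℤ)) : f = g := by
  ext k
  have hk : k = ((residue n k : ℕ) : ℤ) + k / ((n : ℤ) + 1) * ((n : ℤ) + 1) := by
    rw [residue_val, mul_comm, Int.emod_add_mul_ediv]
  rw [hk, f.map_add_mul, g.map_add_mul, h]

lemma extend_nonneg_iff {n m : ℕ} (φ : Fin (n + 1) →o Fin (m + 1)) (k : ℤ) :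
    0 ≤ extend φ k ↔ 0 ≤ k := by
  have h0 : 0 ≤ extend φ 0 := by rw [extend_apply]; simp
  constructor
  · intro h
    by_contra! hk
    have h1 := (extend φ).monotone' (show k ≤ (n : ℤ) + (-1) * ((n : ℤ) + 1) by linarith)
    rw [ParaHom.map_add_mul] at h1
    have h2 := extend_coe φ (Fin.last n)
    rw [Fin.val_last] at h2
    have h3 := (φ (Fin.last n)).2
    omega
  · intro h
    exact h0.trans ((extend φ).monotone' h)

/-- The inclusion `j : Δ ⟶ Λ`, the identity on objects. -/
def incl : SimplexCategory ⥤ CyclicCat where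
  obj n := ⟨n.len⟩
  map φ := mkHom (extend φ.toOrderHom)
  map_id n := congrArg mkHom (ParaHom.ext_fin fun i => extend_coe _ i)
  map_comp φ ψ := (congrArg mkHom (ParaHom.ext_fin fun i => by
    change _ = extend ψ.toOrderHom (extend φ.toOrderHom _)
    rw [extend_coe, extend_coe, extend_coe]
    rfl))

/-- The automorphism of `⟨n⟩` represented by translation by `a`. -/
def rotation (c : CyclicCat) (a : ℤ) : Aut c where
  hom := mkHom (ParaHom.shift c.len a)
  inv := mkHom (ParaHom.shift c.len (-a))
  hom_inv_id := congrArg mkHom (ParaHom.ext (funext fun k => add_neg_cancel_right k a))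
  inv_hom_id := congrArg mkHom (ParaHom.ext (funext fun k => neg_add_cancel_right k a))

/-- Every automorphism of `⟨n⟩` is represented by a translation. -/
lemma exists_rotation {c : CyclicCat} (g : Aut c) : ∃ a : ℤ, rotation c a = g := by
  obtain ⟨F, hF⟩ := mkHom_surjective g.hom
  obtain ⟨G, hG⟩ := mkHom_surjective g.inv
  have h1 : mkHom (F.comp G) = mkHom (ParaHom.id c.len) := by
    rw [← mkHom_comp, hF, hG]; exact g.hom_inv_id
  have h2 : mkHom (G.comp F) = mkHom (ParaHom.id c.len) := by
    rw [← mkHom_comp, hF, hG]; exact g.inv_hom_id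
  obtain ⟨x, hx⟩ := (mkHom_eq_iff _ _).1 h1
  obtain ⟨y, hy⟩ := (mkHom_eq_iff _ _).1 h2
  have hinj : StrictMono F := by
    refine F.monotone'.strictMono_of_injective fun u v huv => ?_
    have hu : u = G (F u) + x * _ := hx u
    have hv : v = G (F v) + x * _ := hx v
    rw [hu, hv, huv]
  have hsurj : ∀ v, ∃ u, F u = v := fun v => ⟨G v + y * ((c.len : ℤ) + 1), by
    rw [F.map_add_mul]; exact (hy v).symm⟩
  have hstep : ∀ k, F (k + 1) = F k + 1 := by
    intro k
    obtain ⟨u, hu⟩ := hsurj (F k + 1)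
    have h1 : k < u := hinj.lt_iff_lt.1 (by omega)
    have h2 : F (k + 1) ≤ F u := F.monotone' (by omega)
    have h3 : F k < F (k + 1) := hinj (by omega)
    omega
  have hF0 : ∀ k, F k = k + F 0 := by
    intro k
    induction k using Int.induction_on with
    | zero => simp
    | succ i ih => rw [hstep, ih]; ring
    | pred i ih =>
      have := hstep (-(i : ℤ) - 1)
      rw [sub_add_cancel, ih] at this
      linarith
  refine ⟨F 0, Iso.ext ?_⟩
  rw [← hF]
  exact congrArg mkHom (ParaHom.ext (funext fun k => (hF0 k).symm))

/-- Canonical factorization: every morphism `⟨n⟩ ⟶ ⟨m⟩` of `Λ` is uniquely an automorphism of `⟨n⟩`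
followed by a morphism of `Δ`. -/
theorem canonical_factorization {n m : SimplexCategory} (f : incl.obj n ⟶ incl.obj m) :
    ∃! p : Aut (incl.obj n) × (n ⟶ m), p.1.hom ≫ incl.map p.2 = f := by
  obtain ⟨F, rfl⟩ := mkHom_surjective f
  change ParaHom n.len m.len at F
  -- the first integer at which `F` is nonnegative
  obtain ⟨a, ha, hmin⟩ : ∃ a : ℤ, 0 ≤ F a ∧ ∀ k, 0 ≤ F k → a ≤ k := by
    have hm : (0 : ℤ) < (m.len : ℤ) + 1 := by positivity
    refine Int.exists_least_of_bdd (P := fun k => 0 ≤ F k) ?_ ?_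
    · have h := F.map_add_mul 0 (-(|F 0| + 1))
      refine ⟨0 + -(|F 0| + 1) * ((n.len : ℤ) + 1), fun k hk => ?_⟩
      by_contra! hlt
      have h1 := F.monotone' hlt.le
      rw [h] at h1
      have h2 := le_abs_self (F 0)
      have h3 := abs_nonneg (F 0)
      nlinarith
    · refine ⟨0 + |F 0| * ((n.len : ℤ) + 1), ?_⟩
      rw [F.map_add_mul]
      have h2 := neg_abs_le (F 0)
      have h3 := abs_nonneg (F 0)
      nlinarith
  have hlt : ∀ k, k < a → F k < 0 := fun k hk => by
    by_contra! h
    exact absurd (hmin k h) (by omega)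
  have hF : ∀ i : Fin (n.len + 1), 0 ≤ F (i + a) ∧ F (i + a) < (m.len : ℤ) + 1 := by
    intro i
    refine ⟨ha.trans (F.monotone' (by omega)), ?_⟩
    have h1 := hlt ((i : ℤ) + a + (-1) * ((n.len : ℤ) + 1)) (by have := i.2; omega)
    rw [F.map_add_mul] at h1
    linarith
  let φ : Fin (n.len + 1) →o Fin (m.len + 1) :=
    { toFun := fun i => ⟨(F (i + a)).toNat, by have := hF i; omega⟩
      monotone' := by
        intro i i' h
        rw [Fin.le_def] at h ⊢
        exact Int.toNat_le_toNat (F.monotone' (by omega)) }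
  have hφ : extend φ = (ParaHom.shift n.len a).comp F := ParaHom.ext_fin fun i => by
    rw [extend_coe]
    exact Int.toNat_of_nonneg (hF i).1
  refine ⟨(rotation _ (-a), SimplexCategory.Hom.mk φ), ?_, ?_⟩
  · have hs : (ParaHom.shift n.len (-a)).comp (extend φ) = F := by
      rw [hφ]
      exact ParaHom.ext (funext fun k => congrArg F (neg_add_cancel_right k a))
    exact congrArg (mkHom (a := incl.obj n) (b := incl.obj m)) hs
  · rintro ⟨g, ψ⟩ h
    obtain ⟨b, rfl⟩ := exists_rotation g
    obtain ⟨c, hc⟩ := (mkHom_eq_iff (a := incl.obj n) (b := incl.obj m)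
      ((ParaHom.shift n.len b).comp (extend ψ.toOrderHom)) F).1 h
    -- absorb the deck transformation into the rotation
    have hc' : ∀ k, F k = extend ψ.toOrderHom (k + b + c * ((n.len : ℤ) + 1)) := by
      intro k
      rw [ParaHom.map_add_mul]
      exact hc k
    have hab : a + b + c * ((n.len : ℤ) + 1) = 0 := by
      apply le_antisymm
      · have h1 := hmin (-b - c * ((n.len : ℤ) + 1)) (by
          rw [hc', extend_nonneg_iff]; linarith)
        linarith
      · rw [hc', extend_nonneg_iff] at ha
        exact ha
    refine Prod.ext ?_ ?_
    · refine Iso.ext ((mkHom_eq_iff _ _).2 ⟨c, fun k => ?_⟩)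
      change k + -a = k + b + c * ((n.len : ℤ) + 1)
      linarith
    · ext i : 3
      have h1 : extend ψ.toOrderHom ((i : ℕ) : ℤ) = extend φ ((i : ℕ) : ℤ) := by
        rw [hφ]
        change _ = F ((i : ℕ) + a)
        rw [hc']
        congr 1
        linarith
      rw [extend_coe, extend_coe] at h1
      exact Fin.ext (by exact_mod_cast h1)

/-- The automorphism part of the canonical factorization. -/
def autPart {n m : SimplexCategory} (f : incl.obj n ⟶ incl.obj m) : Aut (incl.obj n) :=
  (canonical_factorization f).choose.1

lemma autPart_eq {n m : SimplexCategory} {f : incl.obj n ⟶ incl.obj m} {g : Aut (incl.obj n)}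
    {φ : n ⟶ m} (h : g.hom ≫ incl.map φ = f) : autPart f = g :=
  (congrArg Prod.fst ((canonical_factorization f).choose_spec.2 (g, φ) h)).symm

lemma exists_autPart {n m : SimplexCategory} (f : incl.obj n ⟶ incl.obj m) :
    ∃ φ : n ⟶ m, (autPart f).hom ≫ incl.map φ = f :=
  ⟨_, (canonical_factorization f).choose_spec.1⟩

lemma autPart_comp {n m l : SimplexCategory} (f : incl.obj n ⟶ incl.obj m) (φ : m ⟶ l) :
    autPart (f ≫ incl.map φ) = autPart f := by
  obtain ⟨ψ, hψ⟩ := exists_autPart f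
  refine autPart_eq (φ := ψ ≫ φ) ?_
  rw [incl.map_comp, ← Category.assoc, hψ]

/-- The simplicial set `Λ_*` of the crossed simplicial group `Λ`: its `n`-simplices are the
automorphisms of `⟨n⟩`, and `θ : [k] ⟶ [n]` sends `g` to the automorphism `θ^* g` of `⟨k⟩` for which
`g ∘ θ = ψ ∘ θ^* g` with `ψ : [k] ⟶ [n]` in `Δ`. -/
def autSSet : SSet.{0} where
  obj n := Aut (incl.obj n.unop)
  map θ := ↾fun g => autPart (incl.map θ.unop ≫ g.hom)
  map_id n := by
    refine ConcreteCategory.hom_ext _ _ fun g => autPart_eq (φ := 𝟙 _) ?_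
    change g.hom ≫ incl.map (𝟙 _) = incl.map (𝟙 _) ≫ g.hom
    simp
  map_comp {n m l} θ η := by
    refine ConcreteCategory.hom_ext _ _ fun g => ?_
    change autPart (incl.map (η.unop ≫ θ.unop) ≫ g.hom)
      = autPart (incl.map η.unop ≫ (autPart (incl.map θ.unop ≫ g.hom)).hom)
    obtain ⟨ψ, hψ⟩ := exists_autPart (incl.map θ.unop ≫ g.hom)
    rw [incl.map_comp, Category.assoc]
    conv_lhs => rw [← hψ]
    rw [← Category.assoc, autPart_comp]

/-- The functor `j^* : cSet ⟶ sSet` from cyclic sets to simplicial sets. -/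
def underlyingSSet : (CyclicCatᵒᵖ ⥤ Type) ⥤ SSet.{0} :=
  (Functor.whiskeringLeft SimplexCategoryᵒᵖ CyclicCatᵒᵖ Type).obj incl.op

/-- The functor `j^* Λ[-] : Λ ⟶ sSet`. -/
def cyclicRep : CyclicCat ⥤ SSet.{0} := yoneda ⋙ underlyingSSet

/-- The functor `S¹ × - : Top ⟶ Top`. -/
def circleProd : TopCat.{0} ⥤ TopCat.{0} where
  obj X := TopCat.of (Circle × X)
  map f := TopCat.ofHom ((ContinuousMap.id Circle).prodMap f.hom)

/-- The point `[σ, x]` of the geometric realization `|X|` given by a `k`-simplex `σ` of `X` and a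
point `x` of the topological `k`-simplex. -/
def realizationPoint {X : SSet.{0}} {k : SimplexCategory} (σ : X.obj (op k))
    (x : stdSimplex ℝ (Fin (k.len + 1))) : SSet.toTop.obj X :=
  SSet.toTop.map (SSet.yonedaEquiv.symm σ) ((SimplexCategory.toTopHomeo k).symm x)

/-- The action of an automorphism of `⟨k⟩` on the topological `k`-simplex, permuting vertices. -/
def vertexAction {k : SimplexCategory} (g : Aut (incl.obj k))
    (x : stdSimplex ℝ (Fin (k.len + 1))) : stdSimplex ℝ (Fin (k.len + 1)) :=
  stdSimplex.map (underlying g.hom) x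

end CyclicCat

/-- The map on path components induced by a continuous map. -/
def ZerothHomotopy.induced {X Y : Type*} [TopologicalSpace X] [TopologicalSpace Y] (f : C(X, Y)) :
    ZerothHomotopy X → ZerothHomotopy Y :=
  ZerothHomotopy.lift (fun x => ZerothHomotopy.mk (f x))
    fun _ _ p => ZerothHomotopy.sound (p.map f.continuous)

/-- The map `π_N(X, x) → π_N(Y, f x)` induced by a continuous map. -/
def HomotopyGroup.induced (N : Type*) {X Y : Type*} [TopologicalSpace X] [TopologicalSpace Y]
    (f : C(X, Y)) (x : X) : HomotopyGroup N X x → HomotopyGroup N Y (f x) :=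
  Quotient.map' (s₁ := GenLoop.Homotopic.setoid N x) (s₂ := GenLoop.Homotopic.setoid N (f x))
    (fun γ => ⟨f.comp γ.1, fun y hy => congrArg f (γ.2 y hy)⟩)
    fun _ _ h => h.map fun H => H.compContinuousMap f

/-- A weak homotopy equivalence: a continuous map inducing bijections on path components and
isomorphisms on all homotopy groups at all base points. -/
def IsWeakHomotopyEquiv {X Y : Type*} [TopologicalSpace X] [TopologicalSpace Y] (f : C(X, Y)) :
    Prop :=
  Function.Bijective (ZerothHomotopy.induced f) ∧
    ∀ (n : ℕ) (x : X), Function.Bijective (HomotopyGroup.induced (Fin (n + 1)) f x)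

/-- A weak equivalence of simplicial sets: the geometric realization is a weak homotopy
equivalence. -/
def SSet.IsWeakEquiv {X Y : SSet.{0}} (f : X ⟶ Y) : Prop :=
  IsWeakHomotopyEquiv (SSet.toTop.map f).hom

end

/-!
A simplex of `j^* Λ[n]` is a monotone map `F : ℤ → ℤ` with `F (i + k + 1) = F i + n + 1`, up to
adding multiples of `n + 1`. Given barycentric coordinates `x`, place the mass `xᵢ` at the integer
`F i` for `0 ≤ i ≤ k`. This turns `[F, x]` into a probability measure on `ℤ`, supported in a window
`v, …, v + n + 1`, well defined up to translation by `n + 1`. Both coordinates of the homeomorphism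
`Φ_n` are read off this measure:

* the masses of the residue classes modulo `n + 1` are the barycentric coordinates of the point
  of `|Δ[n]|` (`simplexMap`);
* the negative mean of `u ↦ ⌊u / (n + 1)⌋`, called `winding`, is the coordinate in `S¹ = ℝ / ℤ`
  (`circleProj`). Composing with a morphism of `Δ` on the target does not change these floors, so
  this coordinate depends only on the automorphism part and is induced by a map `circleMap` from
  `|Λ_*|` to `S¹`.

Every point lies in the image of an `(n + 1)`-simplex `prism n v`, whose vertices go to
`v, …, v + n + 1` (`exists_prism_point`); as `v` matters only modulo `n + 1`, the space
`|j^* Λ[n]|` is compact. The map `Φ_n` is injective because, for a measure supported in such a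
window, the distribution function is the truncation to `[0, 1]` of a function of `j` computed from
the winding and the residue masses (`prism_cdf`, `sum_mul_ediv_sub`), so that the two coordinates
determine the measure, and the measure determines the point (`prism_point_congr_of_le`). It is
surjective because masses on `0, …, n` can be moved up by `n + 1`, starting from the lowest, until
any prescribed winding is reached (`comparison_surjective`). A continuous bijection from a compact
space to a Hausdorff space is a homeomorphism. The case `n = 0` gives `|Λ_*| ≃ S¹`.

For the second part, a morphism of `Λ` is an automorphism, which induces an isomorphism, followed by
a morphism of `Δ`, which by naturality is compatible with the projections to `S¹`. These projections
are weak equivalences since `|Δ[n]|` is convex (`IsWeakHomotopyEquiv.of_convex_fiber`).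
-/

open CategoryTheory Opposite

/-! ### Points of the geometric realization -/

namespace CyclicCat

/-- The point `[σ, x]` through the unit of the adjunction between realization and singular set. -/
lemma realizationPoint_eq {X : SSet.{0}} {k : SimplexCategory} (σ : X.obj (op k))
    (x : stdSimplex ℝ (Fin (k.len + 1))) :
    realizationPoint σ x =
      TopCat.toSSetObjEquiv _ _ ((sSetTopAdj.unit.app X).app (op k) σ) x := by
  have h := sSetTopAdj_unit_app_app_down X (op k) σ
  exact (ConcreteCategory.congr_hom
    (show (_ : SimplexCategory.toTop.obj k ⟶ SSet.toTop.obj X) = _ from h) (ULift.up x)).symm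

lemma continuous_realizationPoint {X : SSet.{0}} {k : SimplexCategory} (σ : X.obj (op k)) :
    Continuous (realizationPoint σ) :=
  (SSet.toTop.map (SSet.yonedaEquiv.symm σ)).hom.continuous.comp
    (SimplexCategory.toTopHomeo k).symm.continuous

lemma realizationPoint_map {X : SSet.{0}} {k l : SimplexCategory} (θ : l ⟶ k) (σ : X.obj (op k))
    (x : stdSimplex ℝ (Fin (l.len + 1))) :
    realizationPoint (X.map θ.op σ) x = realizationPoint σ (stdSimplex.map θ x) := by
  unfold realizationPoint
  rw [SimplexCategory.toTopHomeo_symm_naturality_apply, ← SSet.yonedaEquiv_symm_naturality_left,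
    Functor.map_comp]
  rfl

lemma toTop_map_realizationPoint {X Y : SSet.{0}} (f : X ⟶ Y) {k : SimplexCategory}
    (σ : X.obj (op k)) (x : stdSimplex ℝ (Fin (k.len + 1))) :
    SSet.toTop.map f (realizationPoint σ x) = realizationPoint (f.app _ σ) x := by
  unfold realizationPoint
  rw [← SSet.yonedaEquiv_symm_comp, Functor.map_comp]
  rfl

lemma realizationPoint_stdSimplex {n k : SimplexCategory} (φ : k ⟶ n)
    (x : stdSimplex ℝ (Fin (k.len + 1))) :
    realizationPoint (X := SSet.stdSimplex.{0}.obj n) (SSet.stdSimplex.objEquiv.symm φ) x =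
      (SimplexCategory.toTopHomeo n).symm (stdSimplex.map φ x) := by
  rw [SimplexCategory.toTopHomeo_symm_naturality_apply, realizationPoint,
    ← SSet.yonedaEquiv_map, Equiv.symm_apply_apply]

/-- Maps out of `|X|` are determined by their values at the points `[σ, x]`. -/
lemma toTop_hom_ext {X : SSet.{0}} {Y : TopCat.{0}} {f g : SSet.toTop.obj X ⟶ Y}
    (h : ∀ (k : SimplexCategory) (σ : X.obj (op k)) (x : stdSimplex ℝ (Fin (k.len + 1))),
      f (realizationPoint σ x) = g (realizationPoint σ x)) : f = g := by
  apply (sSetTopAdj.homEquiv X Y).injective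
  rw [Adjunction.homEquiv_unit, Adjunction.homEquiv_unit]
  ext k σ
  apply (TopCat.toSSetObjEquiv Y k).injective
  ext x
  have := h k.unop σ x
  rw [realizationPoint_eq] at this
  exact this

/-- Every point of `|X|` has the form `[σ, x]`: two maps into an indiscrete space that agree on
all such points are equal. -/
lemma exists_realizationPoint {X : SSet.{0}} (p : SSet.toTop.obj X) :
    ∃ (k : SimplexCategory) (σ : X.obj (op k)) (x : stdSimplex ℝ (Fin (k.len + 1))),
      realizationPoint σ x = p := by
  let Y : TopCat.{0} := TopCat.trivial.obj (ULift Prop)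
  let P : SSet.toTop.obj X → Prop := fun p =>
    ∃ (k : SimplexCategory) (σ : X.obj (op k)) (x : stdSimplex ℝ (Fin (k.len + 1))),
      realizationPoint σ x = p
  let f : SSet.toTop.obj X ⟶ Y :=
    TopCat.ofHom (Y := Y) ⟨fun p => (⟨P p⟩ : ULift Prop), continuous_top⟩
  let g : SSet.toTop.obj X ⟶ Y :=
    TopCat.ofHom (Y := Y) ⟨fun _ => (⟨True⟩ : ULift Prop), continuous_top⟩
  have hfg : f = g := toTop_hom_ext fun k σ x =>
    congrArg ULift.up (eq_true (show P _ from ⟨k, σ, x, rfl⟩))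
  have h := congrArg (fun u : SSet.toTop.obj X ⟶ Y => ULift.down (u p : ULift Prop)) hfg
  exact of_eq_true h

/-- A compatible family of continuous maps out of the topological simplices glues to a continuous
map out of the realization. -/
lemma exists_toTop_desc {X : SSet.{0}} {Y : TopCat.{0}}
    (c : ∀ k : SimplexCategory, X.obj (op k) → C(stdSimplex ℝ (Fin (k.len + 1)), Y))
    (hc : ∀ {k l : SimplexCategory} (θ : l ⟶ k) (σ : X.obj (op k))
      (x : stdSimplex ℝ (Fin (l.len + 1))), c l (X.map θ.op σ) x = c k σ (stdSimplex.map θ x)) :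
    ∃ f : SSet.toTop.obj X ⟶ Y, ∀ (k : SimplexCategory) (σ : X.obj (op k))
      (x : stdSimplex ℝ (Fin (k.len + 1))), f (realizationPoint σ x) = c k σ x := by
  let s : X ⟶ TopCat.toSSet.obj Y :=
    { app := fun k => ↾fun σ => (TopCat.toSSetObjEquiv Y k).symm (c k.unop σ)
      naturality := fun k l θ => by
        ext σ
        apply (TopCat.toSSetObjEquiv Y l).injective
        ext x
        exact hc θ.unop σ x }
  refine ⟨(sSetTopAdj.homEquiv X Y).symm s, fun k σ x => ?_⟩
  have h := (sSetTopAdj.homEquiv X Y).apply_symm_apply s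
  rw [Adjunction.homEquiv_unit] at h
  have h2 := congrArg (fun u : X ⟶ TopCat.toSSet.obj Y =>
    TopCat.toSSetObjEquiv Y (op k) (u.app (op k) σ) x) h
  rw [realizationPoint_eq]
  exact h2

end CyclicCat

/-! ### Weak homotopy equivalences -/

lemma ZerothHomotopy.induced_mk {X Y : Type*} [TopologicalSpace X] [TopologicalSpace Y]
    (f : C(X, Y)) (x : X) : induced f (mk x) = mk (f x) := rfl

lemma ZerothHomotopy.induced_comp {X Y Z : Type*} [TopologicalSpace X] [TopologicalSpace Y]
    [TopologicalSpace Z] (g : C(Y, Z)) (f : C(X, Y)) :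
    induced (g.comp f) = induced g ∘ induced f := by
  funext x
  induction x with
  | mk x => rfl

lemma HomotopyGroup.induced_comp (N : Type*) {X Y Z : Type*} [TopologicalSpace X]
    [TopologicalSpace Y] [TopologicalSpace Z] (g : C(Y, Z)) (f : C(X, Y)) (x : X) :
    induced N (g.comp f) x = induced N g (f x) ∘ induced N f x := by
  funext γ
  induction γ using Quotient.inductionOn
  rfl

namespace IsWeakHomotopyEquiv

variable {X Y Z : Type*} [TopologicalSpace X] [TopologicalSpace Y] [TopologicalSpace Z]

lemma comp {g : C(Y, Z)} {f : C(X, Y)} (hg : IsWeakHomotopyEquiv g)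
    (hf : IsWeakHomotopyEquiv f) : IsWeakHomotopyEquiv (g.comp f) := by
  refine ⟨?_, fun n x => ?_⟩
  · rw [ZerothHomotopy.induced_comp]
    exact hg.1.comp hf.1
  · rw [HomotopyGroup.induced_comp]
    exact (hg.2 n _).comp (hf.2 n x)

lemma of_comp_left {g : C(Y, Z)} {f : C(X, Y)} (hg : IsWeakHomotopyEquiv g)
    (h : IsWeakHomotopyEquiv (g.comp f)) : IsWeakHomotopyEquiv f := by
  refine ⟨?_, fun n x => ?_⟩
  · have h' := h.1
    rw [ZerothHomotopy.induced_comp] at h'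
    exact (Function.Bijective.of_comp_iff' hg.1 _).1 h'
  · have h' := h.2 n x
    rw [HomotopyGroup.induced_comp] at h'
    exact (Function.Bijective.of_comp_iff' (hg.2 n _) _).1 h'

/-- A map isomorphic to the projection of `Y × s` onto `Y`, with `s` convex, is a weak homotopy
equivalence: maps into `s` are homotopic along straight lines, which are constant wherever the two
maps agree, so nothing is lost relative to the boundary of a cube. -/
lemma of_convex_fiber {E : Type*} [AddCommGroup E] [Module ℝ E] [TopologicalSpace E]
    [ContinuousAdd E] [ContinuousSMul ℝ E] {s : Set E} (hs : Convex ℝ s)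
    (hne : s.Nonempty) (e : X ≃ₜ Y × s) (p : C(X, Y)) (hp : ∀ x, (e x).1 = p x) :
    IsWeakHomotopyEquiv p := by
  obtain ⟨b, hb⟩ := hne
  have hpe : ∀ z, p (e.symm z) = z.1 := fun z => by rw [← hp, e.apply_symm_apply]
  -- the straight segment in `s`
  let L : unitInterval × s × s → s := fun q =>
    ⟨(1 - (q.1 : ℝ)) • (q.2.1 : E) + (q.1 : ℝ) • (q.2.2 : E),
      hs q.2.1.2 q.2.2.2 (sub_nonneg.2 q.1.2.2) q.1.2.1 (by ring)⟩
  have hL : Continuous L := by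
    apply Continuous.subtype_mk
    fun_prop
  have hL0 : ∀ u v, L (0, u, v) = u := fun u v => Subtype.ext (by simp [L])
  have hL1 : ∀ u v, L (1, u, v) = v := fun u v => Subtype.ext (by simp [L])
  have hLc : ∀ t u, L (t, u, u) = u := fun t u => Subtype.ext (by
    change (1 - (t : ℝ)) • (u : E) + (t : ℝ) • (u : E) = u
    rw [← add_smul, sub_add_cancel, one_smul])
  refine ⟨⟨?_, ?_⟩, fun n x => ⟨?_, ?_⟩⟩
  · intro x y h
    induction x with
    | mk x =>
    induction y with
    | mk y =>
    obtain ⟨γ⟩ : Joined (p x) (p y) := Quotient.exact h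
    refine ZerothHomotopy.sound
      { toFun := fun t => e.symm (γ t, L (t, (e x).2, (e y).2))
        continuous_toFun := by fun_prop
        source' := ?_
        target' := ?_ }
    · rw [hL0, γ.source, ← hp]; simp
    · rw [hL1, γ.target, ← hp]; simp
  · intro y
    induction y with
    | mk y =>
    exact ⟨.mk (e.symm (y, ⟨b, hb⟩)), by rw [ZerothHomotopy.induced_mk, hpe]⟩
  · intro γ δ h
    induction γ using Quotient.inductionOn with
    | h γ =>
    induction δ using Quotient.inductionOn with
    | h δ =>
    obtain ⟨H⟩ : ContinuousMap.HomotopicRel (p.comp γ.1) (p.comp δ.1) (Cube.boundary _) :=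
      Quotient.exact h
    have hγ : ∀ y, γ.1 y = e.symm (p (γ.1 y), (e (γ.1 y)).2) := fun y => by
      rw [← hp]; simp
    have hδ : ∀ y, δ.1 y = e.symm (p (δ.1 y), (e (δ.1 y)).2) := fun y => by
      rw [← hp]; simp
    refine Quotient.sound ⟨
      { toFun := fun q => e.symm (H q, L (q.1, (e (γ.1 q.2)).2, (e (δ.1 q.2)).2))
        continuous_toFun := by fun_prop
        map_zero_left := fun y => ?_
        map_one_left := fun y => ?_
        prop' := fun t y hy => ?_ }⟩
    · rw [hL0, H.apply_zero]
      exact (hγ y).symm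
    · rw [hL1, H.apply_one]
      exact (hδ y).symm
    · change e.symm (H (t, y), L (t, (e (γ.1 y)).2, (e (δ.1 y)).2)) = γ.1 y
      rw [H.eq_fst t hy, (δ.2 y hy).trans (γ.2 y hy).symm, hLc]
      exact (hγ y).symm
  · intro γ
    induction γ using Quotient.inductionOn with
    | h γ =>
    refine ⟨Quotient.mk _ ⟨⟨fun y => e.symm (γ.1 y, (e x).2), by fun_prop⟩, fun y hy => ?_⟩, ?_⟩
    · change e.symm (γ.1 y, (e x).2) = x
      rw [γ.2 y hy, ← hp]; simp
    · exact congrArg (Quotient.mk _) (GenLoop.ext _ _ fun y => hpe (γ.1 y, (e x).2))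

lemma of_homeomorph (e : X ≃ₜ Y) : IsWeakHomotopyEquiv (e : C(X, Y)) :=
  of_convex_fiber (convex_singleton (0 : ℝ)) (Set.singleton_nonempty _)
    (e.trans (Homeomorph.prodUnique Y _).symm) _ fun _ => rfl

end IsWeakHomotopyEquiv

namespace CyclicCat

/-! ### Coordinates of a point of the realization -/

lemma sum_stdSimplex_map_mul {ι κ : Type*} [Fintype ι] [Fintype κ] (f : ι → κ)
    (x : stdSimplex ℝ ι) (h : κ → ℝ) :
    ∑ j, stdSimplex.map f x j * h j = ∑ i, x i * h (f i) := by
  classical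
  have : ∀ j, stdSimplex.map f x j = ∑ i, if f i = j then x i else 0 := fun j => by
    rw [stdSimplex.map_coe, FunOnFinite.linearMap_apply_apply, Finset.sum_filter]
  simp_rw [this, Finset.sum_mul]
  rw [Finset.sum_comm]
  refine Finset.sum_congr rfl fun i _ => ?_
  simp [ite_mul]

lemma stdSimplex_map_apply {ι κ : Type*} [Fintype ι] [Fintype κ] [DecidableEq κ] (f : ι → κ)
    (x : stdSimplex ℝ ι) (j : κ) :
    stdSimplex.map f x j = ∑ i, x i * if f i = j then 1 else 0 := by
  rw [← sum_stdSimplex_map_mul f x fun j' => if j' = j then 1 else 0]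
  simp

/-- The affine function `x ↦ -∑ xᵢ ⌊F i / (m + 1)⌋`. Modulo `1` it is the circle coordinate of the
point `[F, x]`. -/
noncomputable def winding {n m : ℕ} (F : ParaHom n m) (x : stdSimplex ℝ (Fin (n + 1))) : ℝ :=
  -∑ i, x i * ((F ((i : ℕ) : ℤ) / ((m : ℤ) + 1) : ℤ) : ℝ)

lemma continuous_winding {n m : ℕ} (F : ParaHom n m) : Continuous (winding F) := by
  have h : ∀ i, Continuous fun x : stdSimplex ℝ (Fin (n + 1)) => x i := fun i =>
    (continuous_apply i).comp continuous_subtype_val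
  exact (continuous_finsetSum _ fun i _ => (h i).mul continuous_const).neg

lemma winding_of_deck {n m : ℕ} {F G : ParaHom n m} {c : ℤ}
    (h : ∀ k, G k = F k + c * ((m : ℤ) + 1)) (x : stdSimplex ℝ (Fin (n + 1))) :
    winding G x = winding F x - c := by
  have h1 : ∀ i : Fin (n + 1), G ((i : ℕ) : ℤ) / ((m : ℤ) + 1) =
      F ((i : ℕ) : ℤ) / ((m : ℤ) + 1) + c := fun i => by
    rw [h, Int.add_mul_ediv_right _ _ (by positivity)]
  simp only [winding, h1, Int.cast_add, mul_add, Finset.sum_add_distrib, ← Finset.sum_mul,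
    stdSimplex.sum_eq_one]
  ring

lemma winding_extend_comp {n m l : ℕ} (θ : Fin (n + 1) →o Fin (m + 1)) (F : ParaHom m l)
    (x : stdSimplex ℝ (Fin (n + 1))) :
    winding ((extend θ).comp F) x = winding F (stdSimplex.map θ x) := by
  unfold winding
  rw [sum_stdSimplex_map_mul θ x fun j => ((F ((j : ℕ) : ℤ) / ((l : ℤ) + 1) : ℤ) : ℝ)]
  refine congrArg Neg.neg (Finset.sum_congr rfl fun i _ => ?_)
  change x i * ((F (extend θ _) / _ : ℤ) : ℝ) = _
  rw [extend_coe]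

lemma extend_ediv {n m : ℕ} (φ : Fin (n + 1) →o Fin (m + 1)) (k : ℤ) :
    extend φ k / ((m : ℤ) + 1) = k / ((n : ℤ) + 1) := by
  rw [extend_apply, Int.add_mul_ediv_right _ _ (by positivity),
    Int.ediv_eq_zero_of_lt (by positivity) (by exact_mod_cast (φ (residue n k)).2), zero_add]

lemma winding_comp_extend {n m l : ℕ} (F : ParaHom n m) (φ : Fin (m + 1) →o Fin (l + 1))
    (x : stdSimplex ℝ (Fin (n + 1))) : winding (F.comp (extend φ)) x = winding F x := by
  refine congrArg Neg.neg (Finset.sum_congr rfl fun i _ => ?_)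
  change x i * ((extend φ _ / _ : ℤ) : ℝ) = _
  rw [extend_ediv]

/-- The circle coordinate of the points `[f, x]` for a morphism `f` of `Λ`. It does not depend on
the representative of `f`, since a deck transformation changes the winding by an integer. -/
noncomputable def circleCoord {a b : CyclicCat} (f : a ⟶ b) : C(stdSimplex ℝ (Fin (a.len + 1)), Circle) :=
  Quotient.lift (s := ParaHom.orbit a.len b.len)
    (fun F => ⟨fun x => Circle.exp (2 * Real.pi * winding F x),
      Circle.exp.continuous.comp (continuous_const.mul (continuous_winding F))⟩) (by
    rintro F G ⟨c, hc⟩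
    ext1 x
    change Circle.exp _ = Circle.exp _
    rw [winding_of_deck hc, Circle.exp_eq_exp]
    exact ⟨c, by ring⟩) f

lemma circleCoord_incl_comp {k l : SimplexCategory} {b : CyclicCat} (θ : l ⟶ k)
    (f : incl.obj k ⟶ b) (x : stdSimplex ℝ (Fin (l.len + 1))) :
    circleCoord (incl.map θ ≫ f) x = circleCoord f (stdSimplex.map θ x) := by
  obtain ⟨F, rfl⟩ := mkHom_surjective f
  exact congrArg (fun t => Circle.exp (2 * Real.pi * t)) (winding_extend_comp θ.toOrderHom F x)

lemma circleCoord_comp_incl {a : CyclicCat} {m l : SimplexCategory} (f : a ⟶ incl.obj m)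
    (φ : m ⟶ l) : circleCoord (f ≫ incl.map φ) = circleCoord f := by
  obtain ⟨F, rfl⟩ := mkHom_surjective f
  ext1 x
  exact congrArg (fun t => Circle.exp (2 * Real.pi * t)) (winding_comp_extend F φ.toOrderHom x)

lemma circleCoord_autPart {n m : SimplexCategory} (f : incl.obj n ⟶ incl.obj m) :
    circleCoord (autPart f).hom = circleCoord f := by
  obtain ⟨φ, hφ⟩ := exists_autPart f
  rw [← hφ, circleCoord_comp_incl, hφ]

lemma underlying_incl_comp {k l : SimplexCategory} {b : CyclicCat} (θ : l ⟶ k)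
    (f : incl.obj k ⟶ b) : underlying (incl.map θ ≫ f) = underlying f ∘ θ.toOrderHom := by
  obtain ⟨F, rfl⟩ := mkHom_surjective f
  funext i
  exact congrArg (fun j => residue b.len (F j)) (extend_coe θ.toOrderHom i)

/-- The coordinate in `|Δ[n]|` of the points given by a morphism `f` of `Λ`. -/
noncomputable def simplexCoord {a : CyclicCat} {n : SimplexCategory} (f : a ⟶ incl.obj n) :
    C(stdSimplex ℝ (Fin (a.len + 1)), SSet.toTop.obj (SSet.stdSimplex.{0}.obj n)) :=
  ⟨fun x => (SimplexCategory.toTopHomeo n).symm (stdSimplex.map (underlying f) x),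
    (SimplexCategory.toTopHomeo n).symm.continuous.comp (stdSimplex.continuous_map _)⟩

lemma simplexCoord_incl_comp {k l n : SimplexCategory} (θ : l ⟶ k) (f : incl.obj k ⟶ incl.obj n)
    (x : stdSimplex ℝ (Fin (l.len + 1))) :
    simplexCoord (incl.map θ ≫ f) x = simplexCoord f (stdSimplex.map θ x) := by
  refine congrArg (SimplexCategory.toTopHomeo n).symm ?_
  rw [underlying_incl_comp]
  exact (stdSimplex.map_comp_apply (Y := Fin (k.len + 1)) _ _ x).symm

lemma residue_extend {n m : ℕ} (φ : Fin (n + 1) →o Fin (m + 1)) (k : ℤ) :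
    residue m (extend φ k) = φ (residue n k) := by
  rw [extend_apply, residue_add_mul, residue_coe]

lemma underlying_comp_incl {a : CyclicCat} {m l : SimplexCategory} (f : a ⟶ incl.obj m)
    (φ : m ⟶ l) : underlying (f ≫ incl.map φ) = φ.toOrderHom ∘ underlying f := by
  obtain ⟨F, rfl⟩ := mkHom_surjective f
  funext i
  exact residue_extend φ.toOrderHom _

/-! ### The comparison maps -/

/-- The projection `j^* Λ[n] ⟶ Λ_*` onto the automorphism part. -/
noncomputable def autProj (n : SimplexCategory) : cyclicRep.obj (incl.obj n) ⟶ autSSet where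
  app k := ↾fun f => autPart (n := k.unop) (m := n) f
  naturality k l θ := by
    refine ConcreteCategory.hom_ext _ _ fun f => ?_
    change autPart (n := l.unop) (m := n) (incl.map θ.unop ≫ f) =
      autPart (incl.map θ.unop ≫ (autPart (n := k.unop) (m := n) f).hom)
    obtain ⟨φ, hφ⟩ := exists_autPart (n := k.unop) (m := n) f
    conv_lhs => rw [← hφ]
    rw [← Category.assoc, autPart_comp]

lemma exists_circleMap : ∃ e : SSet.toTop.obj autSSet ⟶ TopCat.of Circle,
    ∀ (k : SimplexCategory) (g : autSSet.obj (op k)) (x : stdSimplex ℝ (Fin (k.len + 1))),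
      e (realizationPoint g x) = circleCoord (Iso.hom (X := incl.obj k) (Y := incl.obj k) g) x :=
  exists_toTop_desc (X := autSSet) (Y := TopCat.of Circle)
    (fun k g => circleCoord (Iso.hom (X := incl.obj k) (Y := incl.obj k) g))
    fun {k l} θ g x => by
      change circleCoord (autPart (incl.map θ ≫
        Iso.hom (X := incl.obj k) (Y := incl.obj k) g)).hom x = _
      rw [circleCoord_autPart]
      exact circleCoord_incl_comp θ _ x

/-- The map `|Λ_*| ⟶ S¹`, `[g, x] ↦ exp (2πi w)` with `w` the winding of `g` and `x`. -/
noncomputable def circleMap : SSet.toTop.obj autSSet ⟶ TopCat.of Circle := exists_circleMap.choose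

lemma circleMap_realizationPoint {k : SimplexCategory} (g : Aut (incl.obj k))
    (x : stdSimplex ℝ (Fin (k.len + 1))) :
    circleMap (realizationPoint (X := autSSet) (k := k) g x) = circleCoord g.hom x :=
  exists_circleMap.choose_spec k g x

lemma exists_simplexMap (n : SimplexCategory) :
    ∃ q : SSet.toTop.obj (cyclicRep.obj (incl.obj n)) ⟶ SSet.toTop.obj (SSet.stdSimplex.{0}.obj n),
    ∀ (k : SimplexCategory) (f : (cyclicRep.obj (incl.obj n)).obj (op k))
      (x : stdSimplex ℝ (Fin (k.len + 1))), q (realizationPoint f x) =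
        simplexCoord (a := incl.obj k) f x :=
  exists_toTop_desc (X := cyclicRep.obj (incl.obj n))
    (fun k f => simplexCoord (a := incl.obj k) f)
    fun {_ _} θ f x => simplexCoord_incl_comp θ f x

/-- The map `|j^* Λ[n]| ⟶ |Δ[n]|`, `[f, x] ↦ f_* x`, pushing weights forward along the map of
vertices underlying `f`. -/
noncomputable def simplexMap (n : SimplexCategory) :
    SSet.toTop.obj (cyclicRep.obj (incl.obj n)) ⟶ SSet.toTop.obj (SSet.stdSimplex.{0}.obj n) :=
  (exists_simplexMap n).choose

lemma simplexMap_realizationPoint {n k : SimplexCategory} (f : incl.obj k ⟶ incl.obj n)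
    (x : stdSimplex ℝ (Fin (k.len + 1))) :
    simplexMap n (realizationPoint (X := cyclicRep.obj (incl.obj n)) (k := k) f x) =
      simplexCoord f x :=
  (exists_simplexMap n).choose_spec k f x

/-- The map `|j^* Λ[n]| ⟶ S¹` induced by `|Λ_*| ⟶ S¹`. -/
noncomputable def circleProj (n : SimplexCategory) :
    SSet.toTop.obj (cyclicRep.obj (incl.obj n)) ⟶ TopCat.of Circle :=
  SSet.toTop.map (autProj n) ≫ circleMap

lemma circleProj_realizationPoint {n k : SimplexCategory} (f : incl.obj k ⟶ incl.obj n)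
    (x : stdSimplex ℝ (Fin (k.len + 1))) :
    circleProj n (realizationPoint (X := cyclicRep.obj (incl.obj n)) (k := k) f x) =
      circleCoord f x := by
  change circleMap (SSet.toTop.map (autProj n) _) = _
  exact (congrArg circleMap (toTop_map_realizationPoint (autProj n) (k := k) _ x)).trans
    ((circleMap_realizationPoint _ x).trans (DFunLike.congr_fun (circleCoord_autPart f) x))

/-- The comparison map `|j^* Λ[n]| → S¹ × |Δ[n]|`. -/
noncomputable def comparison (n : SimplexCategory) : C(SSet.toTop.obj (cyclicRep.obj (incl.obj n)),
    Circle × SSet.toTop.obj (SSet.stdSimplex.{0}.obj n)) :=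
  (circleProj n).hom.prodMk (simplexMap n).hom

/-! ### The prism decomposition -/

/-- The point of `|j^* Λ[n]|` given by an equivariant monotone map and barycentric coordinates. -/
noncomputable def point {n k : SimplexCategory} (F : ParaHom k.len n.len)
    (x : stdSimplex ℝ (Fin (k.len + 1))) : SSet.toTop.obj (cyclicRep.obj (incl.obj n)) :=
  realizationPoint (X := cyclicRep.obj (incl.obj n)) (k := k)
    (mkHom (a := incl.obj k) (b := incl.obj n) F) x

lemma exists_point {n : SimplexCategory} (p : SSet.toTop.obj (cyclicRep.obj (incl.obj n))) :
    ∃ (k : SimplexCategory) (F : ParaHom k.len n.len) (x : stdSimplex ℝ (Fin (k.len + 1))),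
      point F x = p := by
  obtain ⟨k, f, x, rfl⟩ := exists_realizationPoint p
  obtain ⟨F, rfl⟩ := mkHom_surjective (a := incl.obj k) (b := incl.obj n) f
  exact ⟨k, F, x, rfl⟩

lemma continuous_point {n k : SimplexCategory} (F : ParaHom k.len n.len) :
    Continuous (point (n := n) F) :=
  continuous_realizationPoint (X := cyclicRep.obj (incl.obj n)) (k := k) _

lemma point_extend_comp {n k l : SimplexCategory} (θ : l ⟶ k) (F : ParaHom k.len n.len)
    (x : stdSimplex ℝ (Fin (l.len + 1))) :
    point (n := n) (k := l) ((extend θ.toOrderHom).comp F) x = point F (stdSimplex.map θ x) :=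
  realizationPoint_map (X := cyclicRep.obj (incl.obj n)) θ
    (mkHom (a := incl.obj k) (b := incl.obj n) F) x

lemma point_of_deck {n k : SimplexCategory} {F G : ParaHom k.len n.len} {c : ℤ}
    (h : ∀ i, G i = F i + c * ((n.len : ℤ) + 1)) (x : stdSimplex ℝ (Fin (k.len + 1))) :
    point G x = point (n := n) F x :=
  congrArg (fun f => realizationPoint (X := cyclicRep.obj (incl.obj n)) (k := k) f x)
    ((mkHom_eq_iff (a := incl.obj k) (b := incl.obj n) F G).2 ⟨c, h⟩).symm

lemma circleProj_point {n k : SimplexCategory} (F : ParaHom k.len n.len)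
    (x : stdSimplex ℝ (Fin (k.len + 1))) :
    circleProj n (point F x) = Circle.exp (2 * Real.pi * winding F x) :=
  circleProj_realizationPoint _ x

lemma simplexMap_point {n k : SimplexCategory} (F : ParaHom k.len n.len)
    (x : stdSimplex ℝ (Fin (k.len + 1))) :
    simplexMap n (point F x) = (SimplexCategory.toTopHomeo n).symm
      (stdSimplex.map (fun i : Fin (k.len + 1) => residue n.len (F ((i : ℕ) : ℤ))) x) :=
  simplexMap_realizationPoint _ x

/-- The `(n + 1)`-simplex of `j^* Λ[n]` sending the vertices `0, …, n + 1` to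
`v, v + 1, …, v + n + 1`. Up to deck transformations there are `n + 1` of them, one for each top
dimensional simplex of a prism decomposition of `S¹ × Δⁿ`. -/
def prism (n : ℕ) (v : ℤ) : ParaHom (n + 1) n where
  toFun i := v + i - i / ((n : ℤ) + 2)
  monotone' := monotone_int_of_le_succ fun i => by
    have h1 : (i + 1) / ((n : ℤ) + 2) ≤ i / ((n : ℤ) + 2) + 1 := by
      have h2 := Int.ediv_le_ediv (show (0 : ℤ) < (n : ℤ) + 2 by positivity)
        (show i + 1 ≤ i + ((n : ℤ) + 2) by omega)
      rwa [Int.add_ediv_of_dvd_right (dvd_refl _), Int.ediv_self (by positivity)] at h2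
    omega
  map_add' i := by
    have h : (((n + 1 : ℕ) : ℤ) + 1) = (n : ℤ) + 2 := by push_cast; ring
    rw [h, Int.add_ediv_of_dvd_right (dvd_refl _), Int.ediv_self (by positivity)]
    ring

lemma prism_coe (n : ℕ) (v : ℤ) (i : Fin (n + 2)) :
    prism n v ((i : ℕ) : ℤ) = v + ((i : ℕ) : ℤ) := by
  change v + ((i : ℕ) : ℤ) - ((i : ℕ) : ℤ) / ((n : ℤ) + 2) = _
  rw [Int.ediv_eq_zero_of_lt (by positivity) (by have := i.2; omega), sub_zero]

/-- A monotone equivariant map sends `0, …, k` into a window of length `n + 2`, hence factors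
through a prism. -/
lemma exists_prism_point {n : SimplexCategory}
    (p : SSet.toTop.obj (cyclicRep.obj (incl.obj n))) :
    ∃ (v : ℤ) (x : stdSimplex ℝ (Fin (n.len + 2))),
      point (k := SimplexCategory.mk (n.len + 1)) (prism n.len v) x = p := by
  obtain ⟨k, F, x, rfl⟩ := exists_point p
  have h0 : ∀ i : Fin (k.len + 1), F 0 ≤ F ((i : ℕ) : ℤ) := fun i => F.monotone' (by positivity)
  have h1 : ∀ i : Fin (k.len + 1), F ((i : ℕ) : ℤ) ≤ F 0 + ((n.len : ℤ) + 1) := fun i => by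
    rw [← F.map_add']
    exact F.monotone' (by have := i.2; omega)
  let θ : k ⟶ SimplexCategory.mk (n.len + 1) := SimplexCategory.Hom.mk
    { toFun := fun i => ⟨(F ((i : ℕ) : ℤ) - F 0).toNat, by
        change _ < n.len + 1 + 1
        have := h0 i; have := h1 i; omega⟩
      monotone' := fun i j hij => by
        rw [Fin.le_def] at hij ⊢
        exact Int.toNat_le_toNat (sub_le_sub_right (F.monotone' (by exact_mod_cast hij)) _) }
  refine ⟨F 0, stdSimplex.map θ x, ?_⟩
  rw [← point_extend_comp]
  congr 1
  refine ParaHom.ext_fin fun i => ?_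
  change prism n.len (F 0) (extend θ.toOrderHom _) = _
  rw [extend_coe]
  refine (prism_coe _ _ _).trans ?_
  change F 0 + ((F ((i : ℕ) : ℤ) - F 0).toNat : ℤ) = _
  have := h0 i
  omega

lemma prism_point_residue {n : SimplexCategory} (v : ℤ) (x : stdSimplex ℝ (Fin (n.len + 2))) :
    point (n := n) (k := SimplexCategory.mk (n.len + 1)) (prism n.len v) x =
      point (k := SimplexCategory.mk (n.len + 1)) (prism n.len (residue n.len v : ℕ)) x := by
  refine point_of_deck (c := v / ((n.len : ℤ) + 1)) (fun i => ?_) x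
  change v + i - _ = ((residue n.len v : ℕ) : ℤ) + i - _ + _
  have := Int.emod_add_mul_ediv v ((n.len : ℤ) + 1)
  rw [residue_val]
  linarith

instance compactSpace_toTop_cyclicRep (n : SimplexCategory) :
    CompactSpace (SSet.toTop.obj (cyclicRep.obj (incl.obj n))) := by
  let f : Fin (n.len + 1) × stdSimplex ℝ (Fin (n.len + 2)) →
      SSet.toTop.obj (cyclicRep.obj (incl.obj n)) := fun q =>
    point (k := SimplexCategory.mk (n.len + 1)) (prism n.len (q.1 : ℕ)) q.2
  have hf : Continuous f := continuous_prod_of_discrete_left.2 fun v =>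
    continuous_point (n := n) (k := SimplexCategory.mk (n.len + 1)) (prism n.len (v : ℕ))
  have hs : Function.Surjective f := fun p => by
    obtain ⟨v, x, rfl⟩ := exists_prism_point p
    exact ⟨(residue n.len v, x), (prism_point_residue v x).symm⟩
  exact hs.compactSpace hf

/-! ### Injectivity of the comparison maps -/

/-- The numbers `∑ xᵢ ⌊(F i - j) / (m + 1)⌋` depend on `F` and `x` only through the winding and the
masses of the residue classes. -/
lemma sum_mul_ediv_sub {n m : ℕ} (F : ParaHom n m) (x : stdSimplex ℝ (Fin (n + 1))) (j : ℤ) :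
    ∑ i, x i * (((F ((i : ℕ) : ℤ) - j) / ((m : ℤ) + 1) : ℤ) : ℝ) =
      (∑ r, stdSimplex.map (fun i : Fin (n + 1) => residue m (F ((i : ℕ) : ℤ))) x r *
        (((((r : ℕ) : ℤ) - j) / ((m : ℤ) + 1) : ℤ) : ℝ)) - winding F x := by
  rw [sum_stdSimplex_map_mul _ x fun r : Fin (m + 1) =>
    (((((r : ℕ) : ℤ) - j) / ((m : ℤ) + 1) : ℤ) : ℝ), winding, sub_neg_eq_add,
    ← Finset.sum_add_distrib]
  refine Finset.sum_congr rfl fun i _ => ?_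
  rw [← mul_add, ← Int.cast_add, ← Int.add_mul_ediv_right _ _ (by positivity), residue_val]
  congr 3
  have := Int.emod_add_mul_ediv (F ((i : ℕ) : ℤ)) ((m : ℤ) + 1)
  linarith

/-- The distribution function of the masses `x` placed at `v, …, v + n + 1`, expressed through the
numbers of `sum_mul_ediv_sub`: the window is so short that on it these floors only take the values
`0` and `-1` wherever the distribution function is not yet `0` or `1`. -/
lemma prism_cdf {n : ℕ} (v : ℤ) (x : stdSimplex ℝ (Fin (n + 2))) (j : ℤ) :
    ∑ i, x i * (if v + ((i : ℕ) : ℤ) < j then 1 else 0) =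
      max 0 (min 1
        (-∑ i, x i * (((prism n v ((i : ℕ) : ℤ) - j) / ((n : ℤ) + 1) : ℤ) : ℝ))) := by
  simp only [prism_coe]
  have hn : (0 : ℤ) < (n : ℤ) + 1 := by positivity
  have hx := stdSimplex.zero_le x
  have hx1 := stdSimplex.sum_eq_one x
  rcases le_or_gt j v with hj | hj
  · have h1 : ∑ i, x i * (if v + ((i : ℕ) : ℤ) < j then 1 else 0) = 0 :=
      Finset.sum_eq_zero fun i _ => by rw [if_neg (by omega), mul_zero]
    have h2 : 0 ≤ ∑ i, x i * (((v + ((i : ℕ) : ℤ) - j) / ((n : ℤ) + 1) : ℤ) : ℝ) :=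
      Finset.sum_nonneg fun i _ => mul_nonneg (hx i)
        (by exact_mod_cast Int.ediv_nonneg (by omega) hn.le)
    rw [h1, max_eq_left]
    exact (min_le_right _ _).trans (neg_nonpos.2 h2)
  rcases lt_or_ge (v + (n + 1)) j with hj' | hj'
  · have h1 : ∑ i, x i * (if v + ((i : ℕ) : ℤ) < j then 1 else 0) = 1 :=
      (Finset.sum_congr rfl fun i _ => by
        rw [if_pos (by have := i.2; omega), mul_one]).trans hx1
    have h2 : 1 ≤ -∑ i, x i * (((v + ((i : ℕ) : ℤ) - j) / ((n : ℤ) + 1) : ℤ) : ℝ) := by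
      rw [← Finset.sum_neg_distrib, ← hx1]
      refine Finset.sum_le_sum fun i _ => ?_
      have h3 : (v + ((i : ℕ) : ℤ) - j) / ((n : ℤ) + 1) ≤ -1 :=
        Int.le_sub_one_of_lt (Int.ediv_neg_of_neg_of_pos (by have := i.2; omega) hn)
      have h4 : (((v + ((i : ℕ) : ℤ) - j) / ((n : ℤ) + 1) : ℤ) : ℝ) ≤ -1 := by
        exact_mod_cast h3
      nlinarith [hx i]
    rw [h1, min_eq_left h2, max_eq_right zero_le_one]
  · have h1 : -∑ i, x i * (((v + ((i : ℕ) : ℤ) - j) / ((n : ℤ) + 1) : ℤ) : ℝ) =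
        ∑ i, x i * (if v + ((i : ℕ) : ℤ) < j then 1 else 0) := by
      rw [← Finset.sum_neg_distrib]
      refine Finset.sum_congr rfl fun i _ => ?_
      have hi := i.2
      split_ifs with h
      · have h3 : (v + ((i : ℕ) : ℤ) - j) / ((n : ℤ) + 1) = -1 := by
          rw [Int.ediv_eq_iff_of_pos hn]
          constructor <;> linarith
        rw [h3]; simp
      · rw [Int.ediv_eq_zero_of_lt (by omega) (by omega)]; simp
    have h2 : 0 ≤ ∑ i, x i * (if v + ((i : ℕ) : ℤ) < j then (1 : ℝ) else 0) :=
      Finset.sum_nonneg fun i _ => mul_nonneg (hx i) (by split_ifs <;> norm_num)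
    have h3 : ∑ i, x i * (if v + ((i : ℕ) : ℤ) < j then (1 : ℝ) else 0) ≤ 1 := by
      rw [← hx1]
      refine Finset.sum_le_sum fun i _ => mul_le_of_le_one_right (hx i) ?_
      split_ifs <;> norm_num
    rw [h1, min_eq_right h3, max_eq_right h2]

/-- The mass at the integer `u` of the masses `x` placed at `v, …, v + n + 1`. -/
noncomputable def prismMass {n : ℕ} (v : ℤ) (x : stdSimplex ℝ (Fin (n + 2))) (u : ℤ) : ℝ :=
  ∑ i, x i * if v + ((i : ℕ) : ℤ) = u then 1 else 0

lemma prismMass_apply {n : ℕ} (v : ℤ) (x : stdSimplex ℝ (Fin (n + 2))) (i : Fin (n + 2)) :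
    prismMass v x (v + ((i : ℕ) : ℤ)) = x i := by
  unfold prismMass
  simp [Fin.val_inj]

lemma prismMass_eq_zero {n : ℕ} {v : ℤ} (x : stdSimplex ℝ (Fin (n + 2))) {u : ℤ}
    (h : u < v ∨ v + ((n : ℤ) + 1) < u) : prismMass v x u = 0 :=
  Finset.sum_eq_zero fun i _ => by rw [if_neg (by have := i.2; omega), mul_zero]

lemma prismMass_eq_sub {n : ℕ} (v : ℤ) (x : stdSimplex ℝ (Fin (n + 2))) (u : ℤ) :
    prismMass v x u = ∑ i, x i * (if v + ((i : ℕ) : ℤ) < u + 1 then 1 else 0) -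
      ∑ i, x i * (if v + ((i : ℕ) : ℤ) < u then 1 else 0) := by
  rw [prismMass, ← Finset.sum_sub_distrib]
  refine Finset.sum_congr rfl fun i _ => ?_
  rw [← mul_sub]
  congr 1
  rcases lt_trichotomy (v + ((i : ℕ) : ℤ)) u with h | h | h
  · rw [if_neg h.ne, if_pos (by omega), if_pos h, sub_self]
  · rw [if_pos h, if_pos (by omega), if_neg (by omega), sub_zero]
  · rw [if_neg h.ne', if_neg (by omega), if_neg (by omega), sub_self]

/-- Winding and masses of the residue classes together determine the masses on `ℤ`, because they
determine the distribution function. -/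
lemma prismMass_congr {n : ℕ} {v w : ℤ} {x y : stdSimplex ℝ (Fin (n + 2))}
    (h : winding (prism n v) x = winding (prism n w) y)
    (h' : stdSimplex.map (fun i : Fin (n + 2) => residue n (prism n v ((i : ℕ) : ℤ))) x =
      stdSimplex.map (fun i : Fin (n + 2) => residue n (prism n w ((i : ℕ) : ℤ))) y) :
    prismMass v x = prismMass w y := by
  funext u
  simp only [prismMass_eq_sub, prism_cdf, sum_mul_ediv_sub, h, h']

/-- Two prisms with the same masses give the same point: the masses lie on the intersection of the
two windows, and both prisms restrict to the same face there. -/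
lemma prism_point_congr_of_le {n : SimplexCategory} {v w : ℤ} (hvw : v ≤ w)
    {x y : stdSimplex ℝ (Fin (n.len + 2))} (h : prismMass v x = prismMass w y) :
    point (n := n) (k := SimplexCategory.mk (n.len + 1)) (prism n.len v) x =
      point (k := SimplexCategory.mk (n.len + 1)) (prism n.len w) y := by
  -- the windows meet, since some coordinate of `y` is nonzero
  obtain ⟨i₀, hi₀⟩ : ∃ i, y i ≠ 0 := by
    by_contra! hy
    have := stdSimplex.sum_eq_one y
    simp [hy] at this
  have hle : w ≤ v + (n.len + 1) := by
    by_contra! hlt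
    apply hi₀
    rw [← prismMass_apply w, ← h]
    exact prismMass_eq_zero x (Or.inr (by omega))
  obtain ⟨d, rfl⟩ := Int.le.dest hvw
  obtain ⟨l, hl⟩ : ∃ l, n.len + 1 = l + d := Nat.exists_eq_add_of_le' (by omega)
  have hx : ∀ i : Fin (n.len + 2), (i : ℕ) < d → x i = 0 := fun i hi => by
    rw [← prismMass_apply v, h]
    exact prismMass_eq_zero y (Or.inl (by omega))
  have hy : ∀ i : Fin (n.len + 2), l < (i : ℕ) → y i = 0 := fun i hi => by
    rw [← prismMass_apply (v + d), ← h]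
    exact prismMass_eq_zero x (Or.inr (by omega))
  have hxy : ∀ i j : Fin (n.len + 2), (i : ℕ) = j + d → x i = y j := fun i j hij => by
    rw [← prismMass_apply v, h, ← prismMass_apply (v + d)]
    congr 1
    omega
  -- `θ` and `η` are the inclusions of the common face `v + d, …, v + d + l` into the two prisms
  let θ : SimplexCategory.mk l ⟶ SimplexCategory.mk (n.len + 1) := SimplexCategory.Hom.mk
    { toFun := fun i => ⟨i + d, by have := i.2; simp at this ⊢; omega⟩
      monotone' := fun i j hij => by
        rw [Fin.le_def] at hij ⊢
        exact Nat.add_le_add_right hij d }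
  let η : SimplexCategory.mk l ⟶ SimplexCategory.mk (n.len + 1) := SimplexCategory.Hom.mk
    { toFun := fun i => ⟨i, by have := i.2; simp at this ⊢; omega⟩
      monotone' := fun i j hij => hij }
  let e : Fin (l + 1) → Fin (n.len + 2) := fun i => ⟨i, by have := i.2; omega⟩
  let e' : Fin (l + 1) → Fin (n.len + 2) := fun i => ⟨i + d, by have := i.2; omega⟩
  have he : Function.Injective e := fun i j hij => Fin.ext (Fin.mk.inj hij)
  have he' : Function.Injective e' := fun i j hij => Fin.ext (by
    have := Fin.mk.inj hij; omega)
  have hsum : ∑ i, y (e i) = 1 := by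
    rw [← stdSimplex.sum_eq_one y]
    refine Finset.sum_of_injOn e he.injOn (fun _ _ => Finset.mem_coe.2 (Finset.mem_univ _))
      (fun j _ hj => hy j ?_) fun _ _ => rfl
    by_contra! hjl
    exact hj ⟨⟨j, by omega⟩, by simp, rfl⟩
  let z : stdSimplex ℝ (Fin (l + 1)) :=
    ⟨fun i => y (e i), fun i => stdSimplex.zero_le y _, hsum⟩
  have hz : ∀ (f : Fin (l + 1) → Fin (n.len + 2)) (s : stdSimplex ℝ (Fin (n.len + 2))),
      Function.Injective f → (∀ i, s (f i) = y (e i)) → (∀ j, j ∉ Set.range f → s j = 0) →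
      stdSimplex.map f z = s := fun f s hf h1 h2 => by
    refine DFunLike.ext _ _ fun j => ?_
    rw [stdSimplex_map_apply]
    by_cases hj : j ∈ Set.range f
    · obtain ⟨i, rfl⟩ := hj
      simp only [hf.eq_iff]
      rw [h1]
      simp [z]
      rfl
    · rw [h2 j hj]
      exact Finset.sum_eq_zero fun i _ => by rw [if_neg (fun h => hj ⟨i, h⟩), mul_zero]
  have hzx : stdSimplex.map e' z = x := hz e' x he' (fun i => hxy _ _ rfl) fun j hj => hx j (by
    by_contra! hjd
    exact hj ⟨⟨j - d, by omega⟩, Fin.ext (Nat.sub_add_cancel hjd)⟩)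
  have hzy : stdSimplex.map e z = y := hz e y he (fun i => rfl) fun j hj => hy j (by
    by_contra! hjl
    exact hj ⟨⟨j, by omega⟩, rfl⟩)
  have hface : (extend θ.toOrderHom).comp (prism n.len v) =
      (extend η.toOrderHom).comp (prism n.len (v + d)) := by
    refine ParaHom.ext_fin fun i => ?_
    change prism n.len v (extend θ.toOrderHom _) = prism n.len (v + d) (extend η.toOrderHom _)
    rw [extend_coe, extend_coe]
    refine (prism_coe _ _ _).trans (Eq.trans ?_ (prism_coe _ _ _).symm)
    change v + (((i : ℕ) + d : ℕ) : ℤ) = v + d + ((i : ℕ) : ℤ)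
    push_cast
    ring
  have hpx := point_extend_comp (n := n) θ (prism n.len v) z
  have hpy := point_extend_comp (n := n) η (prism n.len (v + d)) z
  rw [hface, hpy] at hpx
  rw [← hzx, ← hzy]
  exact hpx.symm

lemma comparison_injective (n : SimplexCategory) : Function.Injective (comparison n) := by
  intro p q h
  obtain ⟨v, x, rfl⟩ := exists_prism_point p
  obtain ⟨w, y, rfl⟩ := exists_prism_point q
  have h1 := congrArg Prod.fst h
  have h2 := congrArg Prod.snd h
  change circleProj n _ = circleProj n _ at h1
  change simplexMap n _ = simplexMap n _ at h2
  rw [circleProj_point, circleProj_point, Circle.exp_eq_exp] at h1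
  rw [simplexMap_point, simplexMap_point, EmbeddingLike.apply_eq_iff_eq] at h2
  obtain ⟨c, hc⟩ := h1
  -- a deck transformation makes the two winding numbers equal
  have hdeck : ∀ i, prism n.len (w + -c * ((n.len : ℤ) + 1)) i =
      prism n.len w i + -c * ((n.len : ℤ) + 1) := fun i => by
    change w + -c * ((n.len : ℤ) + 1) + i - _ = w + i - _ + _
    ring
  rw [← point_of_deck (n := n) (k := SimplexCategory.mk (n.len + 1)) hdeck y]
  have hw : winding (prism n.len v) x =
      winding (prism n.len (w + -c * ((n.len : ℤ) + 1))) y := by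
    rw [winding_of_deck hdeck]
    have : 2 * Real.pi * winding (prism n.len v) x =
        2 * Real.pi * (winding (prism n.len w) y + c) := hc.trans (by ring)
    have := mul_left_cancel₀ Real.two_pi_pos.ne' this
    rw [this]
    push_cast
    ring
  have hr : stdSimplex.map (fun i : Fin (n.len + 2) =>
        residue n.len (prism n.len v ((i : ℕ) : ℤ))) x =
      stdSimplex.map (fun i : Fin (n.len + 2) =>
        residue n.len (prism n.len (w + -c * ((n.len : ℤ) + 1)) ((i : ℕ) : ℤ))) y := by
    simp only [hdeck, residue_add_mul]
    exact h2
  have hm := prismMass_congr hw hr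
  rcases le_total v (w + -c * ((n.len : ℤ) + 1)) with hle | hle
  · exact prism_point_congr_of_le hle hm
  · exact (prism_point_congr_of_le hle hm.symm).symm

/-! ### Surjectivity of the comparison maps -/

/-- Move the masses `y` of the vertices `0, …, v - 1` up by `n + 1`, and with them the part `d` of
the mass at `v`. The result lives on `v, …, v + n + 1`, and this is the sum of `h` against it. Test
functions `h` of period `n + 1` recover `y`; `h = ⌊· / (n + 1)⌋` gives the winding. -/
lemma sum_split_mul {n : ℕ} (y : Fin (n + 1) → ℝ) (v : Fin (n + 1)) (d : ℝ) (h : ℤ → ℝ) :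
    ∑ i : Fin (n + 2),
      (Fin.snoc (α := fun _ => ℝ) (fun i : Fin (n + 1) => y (v + i) - if i = 0 then d else 0) d :
        Fin (n + 2) → ℝ) i * h (((v : ℕ) : ℤ) + ((i : ℕ) : ℤ)) =
    ∑ j : Fin (n + 1), y j * h (((j : ℕ) : ℤ) + (if j < v then 1 else 0) * ((n : ℤ) + 1)) +
      d * (h (((v : ℕ) : ℤ) + ((n : ℤ) + 1)) - h ((v : ℕ) : ℤ)) := by
  rw [Fin.sum_univ_castSucc, Fin.snoc_last, Fin.val_last]
  simp only [Fin.snoc_castSucc, Fin.val_castSucc, sub_mul, Finset.sum_sub_distrib]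
  have h1 : ∑ i : Fin (n + 1), (if i = 0 then d else 0) * h (((v : ℕ) : ℤ) + ((i : ℕ) : ℤ)) =
      d * h ((v : ℕ) : ℤ) := by
    simp [ite_mul]
  have h2 : ∑ i : Fin (n + 1), y (v + i) * h (((v : ℕ) : ℤ) + ((i : ℕ) : ℤ)) =
      ∑ j : Fin (n + 1), y j * h (((j : ℕ) : ℤ) + (if j < v then 1 else 0) * ((n : ℤ) + 1)) := by
    refine Eq.trans (Finset.sum_congr rfl fun i _ => ?_)
      (Equiv.sum_comp (Equiv.addLeft v) fun j : Fin (n + 1) =>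
        y j * h (((j : ℕ) : ℤ) + (if j < v then 1 else 0) * ((n : ℤ) + 1)))
    change _ = y (v + i) *
      h ((((v + i : Fin (n + 1)) : ℕ) : ℤ) + (if v + i < v then 1 else 0) * ((n : ℤ) + 1))
    congr 2
    have hv := v.2
    have hi := i.2
    have hmod : ((v + i : Fin (n + 1)) : ℕ) = (v + i : ℕ) % (n + 1) := Fin.val_add v i
    rcases lt_or_ge (v + i : ℕ) (n + 1) with hlt | hge
    · rw [Nat.mod_eq_of_lt hlt] at hmod
      rw [if_neg (by rw [Fin.lt_def]; omega), hmod]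
      push_cast
      ring
    · rw [Nat.mod_eq_sub_mod hge, Nat.mod_eq_of_lt (by omega)] at hmod
      rw [if_pos (by rw [Fin.lt_def]; omega), hmod]
      omega
  rw [h1, h2]
  push_cast
  ring

lemma comparison_surjective (n : SimplexCategory) : Function.Surjective (comparison n) := by
  rintro ⟨z, p⟩
  obtain ⟨y, rfl⟩ := (SimplexCategory.toTopHomeo n).symm.surjective p
  -- write `z = exp (-2πi T)` with `0 ≤ T < 1`
  obtain ⟨T, hT0, hT1, rfl⟩ : ∃ T : ℝ, 0 ≤ T ∧ T < 1 ∧ Circle.exp (2 * Real.pi * -T) = z := by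
    obtain ⟨t, rfl⟩ := Circle.exp_surjective z
    refine ⟨Int.fract (-t / (2 * Real.pi)), Int.fract_nonneg _, Int.fract_lt_one _, ?_⟩
    rw [Circle.exp_eq_exp]
    refine ⟨⌊-t / (2 * Real.pi)⌋, ?_⟩
    rw [Int.fract]
    have := Real.pi_pos
    field_simp
    ring
  -- the vertex `v` at which the partial sums of `y` pass `T`
  let P : ℕ → ℝ := fun v => ∑ j : Fin (n.len + 1), if (j : ℕ) < v then y j else 0
  have hP1 : P (n.len + 1) = 1 :=
    (Finset.sum_congr rfl fun j _ => if_pos j.2).trans (stdSimplex.sum_eq_one y)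
  have hP : ∃ v, T < P v := ⟨n.len + 1, by rwa [hP1]⟩
  classical
  obtain ⟨m, hm⟩ : ∃ m, Nat.find hP = m + 1 := Nat.exists_eq_succ_of_ne_zero fun h0 => by
    have := Nat.find_spec hP
    rw [h0] at this
    simp [P] at this
    linarith
  have hPm : P m ≤ T := not_lt.1 (Nat.find_min hP (by omega))
  have hPm1 : T < P (m + 1) := hm ▸ Nat.find_spec hP
  have hmn : m < n.len + 1 := by
    have := Nat.find_min' hP (m := n.len + 1) (by rwa [hP1])
    omega
  let v : Fin (n.len + 1) := ⟨m, hmn⟩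
  have hstep : P (m + 1) = P m + y v := by
    have : y v = ∑ j : Fin (n.len + 1), if j = v then y j else 0 := by simp
    rw [this, ← Finset.sum_add_distrib]
    refine Finset.sum_congr rfl fun j _ => ?_
    rcases lt_trichotomy (j : ℕ) m with h | h | h
    · rw [if_pos (by omega), if_pos h, if_neg (fun e => by simp [e, v] at h), add_zero]
    · rw [if_pos (by omega), if_neg (by omega), if_pos (Fin.ext h), zero_add]
    · rw [if_neg (by omega), if_neg (by omega), if_neg (fun e => by simp [e, v] at h), add_zero]
  -- moving up the mass `P m` below `v` and the part `d` at `v` makes the winding equal to `-T`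
  let d : ℝ := T - P m
  have hd0 : 0 ≤ d := sub_nonneg.2 hPm
  have hd1 : d ≤ y v := by simp only [d]; linarith
  let x₀ : Fin (n.len + 2) → ℝ := Fin.snoc (α := fun _ => ℝ)
    (fun i : Fin (n.len + 1) => y (v + i) - if i = 0 then d else 0) d
  have hx : ∀ h : ℤ → ℝ, _ := sum_split_mul y v d
  let x : stdSimplex ℝ (Fin (n.len + 2)) := ⟨x₀, fun i => by
    refine Fin.lastCases ?_ (fun i => ?_) i
    · simpa [x₀] using hd0
    · simp only [x₀, Fin.snoc_castSucc]
      split_ifs with h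
      · rw [h, add_zero]; linarith
      · rw [sub_zero]; exact stdSimplex.zero_le y _, by
    have := hx fun _ => 1
    simp only [mul_one, sub_self, mul_zero, add_zero, stdSimplex.sum_eq_one] at this
    exact this⟩
  refine ⟨point (n := n) (k := SimplexCategory.mk (n.len + 1)) (prism n.len (v : ℕ)) x,
    Prod.ext ?_ ?_⟩
  · refine (circleProj_point (n := n) (k := SimplexCategory.mk (n.len + 1)) _ x).trans ?_
    suffices winding (prism n.len (v : ℕ)) x = -T by rw [← this]
    refine congrArg Neg.neg ?_
    have h1 := hx fun u => ((u / ((n.len : ℤ) + 1) : ℤ) : ℝ)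
    have h2 : ∀ j : Fin (n.len + 1), ((j : ℕ) : ℤ) / ((n.len : ℤ) + 1) = 0 := fun j =>
      Int.ediv_eq_zero_of_lt (by positivity) (by exact_mod_cast j.2)
    simp only [Int.add_mul_ediv_right _ _ (show (n.len : ℤ) + 1 ≠ 0 by positivity), h2,
      Int.add_ediv_of_dvd_right (dvd_refl ((n.len : ℤ) + 1)),
      Int.ediv_self (show (n.len : ℤ) + 1 ≠ 0 by positivity)] at h1
    simp only [prism_coe]
    refine Eq.trans h1 ?_
    have h3 : ∑ j : Fin (n.len + 1), y j * (((0 + if j < v then 1 else 0 : ℤ)) : ℝ) = P m :=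
      Finset.sum_congr rfl fun j _ => by
        by_cases hj : (j : ℕ) < m
        · rw [if_pos (show j < v from hj), if_pos hj]; simp
        · rw [if_neg (show ¬j < v from hj), if_neg hj]; simp
    rw [h3]
    simp [d]
  · refine (simplexMap_point (n := n) (k := SimplexCategory.mk (n.len + 1)) _ x).trans ?_
    refine congrArg (SimplexCategory.toTopHomeo n).symm (DFunLike.ext _ _ fun r => ?_)
    rw [stdSimplex_map_apply]
    have h1 := hx fun u => if residue n.len u = r then 1 else 0
    have h2 := residue_add_mul n.len ((v : ℕ) : ℤ) 1
    rw [one_mul] at h2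
    simp only [residue_add_mul, h2, residue_coe, sub_self, mul_zero, add_zero] at h1
    refine Eq.trans (Finset.sum_congr rfl fun i _ => ?_) (h1.trans (by simp))
    rw [← prism_coe n.len v i]
    rfl

/-! ### The homeomorphisms and the weak equivalences -/

instance t2Space_toTop_stdSimplex (n : SimplexCategory) :
    T2Space (SSet.toTop.obj (SSet.stdSimplex.{0}.obj n)) :=
  (SimplexCategory.toTopHomeo n).symm.t2Space

/-- The comparison map as a homeomorphism: a continuous bijection from a compact space to a
Hausdorff space. -/
noncomputable def comparisonHomeo (n : SimplexCategory) :
    SSet.toTop.obj (cyclicRep.obj (incl.obj n)) ≃ₜ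
      Circle × SSet.toTop.obj (SSet.stdSimplex.{0}.obj n) :=
  Continuous.homeoOfEquivCompactToT2
    (f := Equiv.ofBijective (comparison n) ⟨comparison_injective n, comparison_surjective n⟩)
    (comparison n).continuous

lemma autProj_surjective (n : SimplexCategory) :
    Function.Surjective (SSet.toTop.map (autProj n)) := fun p => by
  obtain ⟨k, g, x, rfl⟩ := exists_realizationPoint p
  let φ : k ⟶ n := SimplexCategory.Hom.mk ⟨fun _ => 0, fun _ _ _ => le_rfl⟩
  refine ⟨realizationPoint (X := cyclicRep.obj (incl.obj n)) (k := k)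
    (Iso.hom (X := incl.obj k) (Y := incl.obj k) g ≫ incl.map φ) x,
    (toTop_map_realizationPoint (autProj n) (k := k) _ x).trans ?_⟩
  exact congrArg (fun g : autSSet.obj (op k) => realizationPoint (X := autSSet) (k := k) g x)
    (autPart_eq rfl)

/-- Since `|Δ[0]|` is a point, the comparison map for `[0]` amounts to `|Λ_*| → S¹`. -/
lemma circleMap_bijective : Function.Bijective circleMap := by
  have h0 : Subsingleton (SSet.toTop.obj (SSet.stdSimplex.{0}.obj (SimplexCategory.mk 0))) :=
    (SimplexCategory.toTopHomeo (SimplexCategory.mk 0)).injective.subsingleton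
      (β := stdSimplex ℝ (Fin 1))
  constructor
  · intro p q h
    obtain ⟨p, rfl⟩ := autProj_surjective (SimplexCategory.mk 0) p
    obtain ⟨q, rfl⟩ := autProj_surjective (SimplexCategory.mk 0) q
    exact congrArg _ (comparison_injective _ (Prod.ext h (Subsingleton.elim _ _)))
  · intro z
    obtain ⟨p, hp⟩ := comparison_surjective (SimplexCategory.mk 0)
      (z, (SimplexCategory.toTopHomeo _).symm default)
    exact ⟨SSet.toTop.map (autProj _) p, congrArg Prod.fst hp⟩

instance compactSpace_toTop_autSSet : CompactSpace (SSet.toTop.obj autSSet) :=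
  (autProj_surjective (SimplexCategory.mk 0)).compactSpace
    (SSet.toTop.map (autProj (SimplexCategory.mk 0))).hom.continuous

/-- The homeomorphism `|Λ_*| ≃ S¹`. -/
noncomputable def circleHomeo : SSet.toTop.obj autSSet ≃ₜ Circle :=
  Continuous.homeoOfEquivCompactToT2 (f := Equiv.ofBijective circleMap circleMap_bijective)
    circleMap.hom.continuous

lemma toTop_map_cyclicRep_realizationPoint {a : CyclicCat} {n k : SimplexCategory}
    (f : incl.obj n ⟶ a) (h : incl.obj k ⟶ incl.obj n) (x : stdSimplex ℝ (Fin (k.len + 1))) :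
    SSet.toTop.map (cyclicRep.map f)
        (realizationPoint (X := cyclicRep.obj (incl.obj n)) (k := k) h x) =
      realizationPoint (X := cyclicRep.obj a) (k := k) (h ≫ f) x :=
  toTop_map_realizationPoint (cyclicRep.map f) (k := k) h x

lemma map_incl_circleProj {n m : SimplexCategory} (φ : n ⟶ m) :
    SSet.toTop.map (cyclicRep.map (incl.map φ)) ≫ circleProj m = circleProj n :=
  toTop_hom_ext fun k f x => by
    refine (congrArg (circleProj m) (toTop_map_cyclicRep_realizationPoint (incl.map φ) f x)).trans ?_
    refine (circleProj_realizationPoint _ x).trans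
      (Eq.trans ?_ (circleProj_realizationPoint _ x).symm)
    exact DFunLike.congr_fun (circleCoord_comp_incl (m := n) f φ) x

lemma map_incl_simplexMap {n m : SimplexCategory} (φ : n ⟶ m) :
    SSet.toTop.map (cyclicRep.map (incl.map φ)) ≫ simplexMap m =
      simplexMap n ≫ SSet.toTop.map (SSet.stdSimplex.map φ) :=
  toTop_hom_ext fun k f x => by
    refine (congrArg (simplexMap m) (toTop_map_cyclicRep_realizationPoint (incl.map φ) f x)).trans ?_
    refine (simplexMap_realizationPoint _ x).trans (Eq.trans ?_
      (congrArg (SSet.toTop.map (SSet.stdSimplex.map φ))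
        (simplexMap_realizationPoint (k := k) f x)).symm)
    change (SimplexCategory.toTopHomeo m).symm
      (stdSimplex.map (underlying ((show incl.obj k ⟶ incl.obj n from f) ≫ incl.map φ)) x) =
      SSet.toTop.map _ ((SimplexCategory.toTopHomeo n).symm _)
    rw [← SimplexCategory.toTopHomeo_symm_naturality_apply, underlying_comp_incl]
    exact congrArg _ (stdSimplex.map_comp_apply (Y := Fin (n.len + 1)) _ _ x).symm

/-- The natural isomorphism `|j^* Λ[-]| ≅ S¹ × |Δ[-]|`. -/
noncomputable def comparisonIso : incl ⋙ cyclicRep ⋙ SSet.toTop ≅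
    SSet.stdSimplex.{0} ⋙ SSet.toTop ⋙ circleProd :=
  NatIso.ofComponents (fun n => TopCat.isoOfHomeo (X := SSet.toTop.obj (cyclicRep.obj (incl.obj n)))
    (Y := TopCat.of (Circle × SSet.toTop.obj (SSet.stdSimplex.{0}.obj n))) (comparisonHomeo n))
    fun {n m} φ => by
      refine ConcreteCategory.hom_ext _ _ fun p => Prod.ext ?_ ?_
      · exact ConcreteCategory.congr_hom (map_incl_circleProj φ) p
      · exact ConcreteCategory.congr_hom (map_incl_simplexMap φ) p

/-- The circle coordinate is a weak homotopy equivalence, as `|Δ[n]|` is convex. -/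
lemma isWeakHomotopyEquiv_circleProj (n : SimplexCategory) :
    IsWeakHomotopyEquiv (circleProj n).hom :=
  .of_convex_fiber (convex_stdSimplex ℝ (Fin (n.len + 1)))
    (Set.nonempty_coe_sort.1 inferInstance)
    ((comparisonHomeo n).trans ((Homeomorph.refl Circle).prodCongr
      (SimplexCategory.toTopHomeo n))) _ fun _ => rfl

lemma isWeakEquiv_cyclicRep_map_incl {n m : SimplexCategory} (φ : n ⟶ m) :
    SSet.IsWeakEquiv (cyclicRep.map (incl.map φ)) := by
  refine (isWeakHomotopyEquiv_circleProj m).of_comp_left ?_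
  have h := congrArg TopCat.Hom.hom (map_incl_circleProj φ)
  rw [TopCat.hom_comp] at h
  rw [h]
  exact isWeakHomotopyEquiv_circleProj n

lemma isWeakEquiv_of_iso {X Y : SSet.{0}} (f : X ≅ Y) : SSet.IsWeakEquiv f.hom :=
  .of_homeomorph (TopCat.homeoOfIso (SSet.toTop.mapIso f))

lemma isWeakEquiv_cyclicRep_map {n m : SimplexCategory} (f : incl.obj n ⟶ incl.obj m) :
    SSet.IsWeakEquiv (cyclicRep.map f) := by
  obtain ⟨φ, hφ⟩ := exists_autPart f
  let α : incl.obj n ≅ incl.obj n := autPart f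
  have h : SSet.toTop.map (cyclicRep.map f) =
      SSet.toTop.map (cyclicRep.mapIso α).hom ≫ SSet.toTop.map (cyclicRep.map (incl.map φ)) := by
    rw [← Functor.map_comp]
    exact congrArg SSet.toTop.map
      ((congrArg cyclicRep.map hφ).symm.trans (cyclicRep.map_comp α.hom (incl.map φ)))
  unfold SSet.IsWeakEquiv
  rw [h, TopCat.hom_comp]
  exact (isWeakEquiv_cyclicRep_map_incl φ).comp (isWeakEquiv_of_iso _)

end CyclicCat

theorem mainTheorem11 :
    (∃ (e : SSet.toTop.obj CyclicCat.autSSet ≃ₜ Circle)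
        (Φ : CyclicCat.incl ⋙ CyclicCat.cyclicRep ⋙ SSet.toTop ≅
          SSet.stdSimplex.{0} ⋙ SSet.toTop ⋙ CyclicCat.circleProd),
        ∀ (n k : SimplexCategory) (φ : k ⟶ n) (g : Aut (CyclicCat.incl.obj k))
          (x : stdSimplex ℝ (Fin (k.len + 1))),
          (Φ.hom.app n).hom
              (CyclicCat.realizationPoint
                (X := CyclicCat.cyclicRep.obj (CyclicCat.incl.obj n)) (k := k)
                (g.hom ≫ CyclicCat.incl.map φ) x) =
            (e (CyclicCat.realizationPoint (X := CyclicCat.autSSet) (k := k) g x),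
              CyclicCat.realizationPoint
                (X := SSet.stdSimplex.obj n) (k := k)
                (SSet.stdSimplex.objEquiv.symm φ) (CyclicCat.vertexAction g x))) ∧
      ∀ {a b : CyclicCat} (f : a ⟶ b), SSet.IsWeakEquiv (CyclicCat.cyclicRep.map f) := by
  refine ⟨⟨CyclicCat.circleHomeo, CyclicCat.comparisonIso, fun n k φ g x => Prod.ext ?_ ?_⟩,
    fun {a b} f => CyclicCat.isWeakEquiv_cyclicRep_map
      (n := SimplexCategory.mk a.len) (m := SimplexCategory.mk b.len) f⟩
  · refine (CyclicCat.circleProj_realizationPoint _ x).trans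
      (Eq.trans ?_ (CyclicCat.circleMap_realizationPoint g x).symm)
    rw [CyclicCat.circleCoord_comp_incl]
  · refine (CyclicCat.simplexMap_realizationPoint _ x).trans
      (Eq.trans ?_ (CyclicCat.realizationPoint_stdSimplex φ _).symm)
    refine congrArg (SimplexCategory.toTopHomeo n).symm ?_
    rw [CyclicCat.underlying_comp_incl]
    exact (stdSimplex.map_comp_apply (Y := Fin (k.len + 1)) _ _ x).symm
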